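/- For $n\ge 2$ let $K_n$ be the complete graph on $[n]$ and let $\mathcal T_n$ be the set of its spanning trees. In the uniform spanning tree semi-random process, Builder starts with the empty graph $G_0$ on $[n]$. A strategy $\sigma$ is a map that assigns to every pair $(F,T)$, with $F\subseteq E(K_n)$ and $T\in\mathcal T_n$, an edge $\sigma(F,T)\in E(T)$. At round $i\ge 1$ a tree $T_i$ is drawn uniformly at random from $\mathcal T_n$, independently of all other rounds, and $E(G_i)=E(G_{i-1})\cup\{\sigma(E(G_{i-1}),T_i)\}$. For a graph $H$, let $d_{\min}(H)$ be its minimum degree, let $\mathcal P'_H$ be the set of graphs on $[n]$ in which every vertex lies in a (not necessarily induced) copy of $H$, and let $\tau_n(\sigma,\mathcal P'_H)=\min\{i\ge 0: G_i\in\mathcal P'_H\}$ (with $\min\emptyset=\infty$). Theorem. Let $H$ be a fixed finite graph with at least one vertex. Then there are strategies $\sigma_n$ $(n\ge 2)$ and a function $f$ with $f(n)=o(n)$ such that $$\mathbb P\big(\tau_n(\sigma_n,\mathcal P'_H)\le d_{\min}(H)\,n+f(n)\big)\to 1\qquad (n\to\infty).$$ This is within a factor of $2$ of the following deterministic lower bound: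 for every $n\ge 2$, every strategy $\sigma$ and every sequence of offered trees, $\tau_n(\sigma,\mathcal P'_H)\ge d_{\min}(H)\,n/2$. -/

import Mathlib

open Filter Topology MeasureTheory ProbabilityTheory Asymptotics

/-- The set of all spanning trees of the complete graph on the vertex set `Fin n`. -/
def SpanningTree (n : ℕ) : Type := {T : SimpleGraph (Fin n) // T.IsTree}

namespace SpanningTree

/-- The underlying graph of a spanning tree. -/
def graph {n : ℕ} (T : SpanningTree n) : SimpleGraph (Fin n) := T.1

instance (n : ℕ) : Finite (SpanningTree n) :=
  inferInstanceAs (Finite {T : SimpleGraph (Fin n) // T.IsTree})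

instance (n : ℕ) [NeZero n] : Nonempty (SpanningTree n) := by
  obtain ⟨T, -, hT⟩ :=
    (SimpleGraph.connected_top (V := Fin n)).exists_isTree_le
  exact ⟨⟨T, hT⟩⟩

instance (n : ℕ) : MeasurableSpace (SpanningTree n) := ⊤

instance (n : ℕ) : DiscreteMeasurableSpace (SpanningTree n) := ⟨fun _ => trivial⟩

/-- The uniform distribution on the spanning trees of the complete graph on `n ≥ 1` vertices. -/
noncomputable def uniform (n : ℕ) : Measure (SpanningTree n) := uniformOn Set.univ

instance (n : ℕ) [NeZero n] : IsProbabilityMeasure (uniform n) :=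
  isProbabilityMeasure_uniformOn Set.finite_univ Set.univ_nonempty

end SpanningTree

/-- A strategy of Builder: given the graph `F` built so far (a set of edges of the complete graph)
and the spanning tree `T` offered in the present round, it selects an edge of `T`. -/
structure Strategy (n : ℕ) where
  choose : SimpleGraph (Fin n) → SpanningTree n → Sym2 (Fin n)
  choose_mem : ∀ (F : SimpleGraph (Fin n)) (T : SpanningTree n), choose F T ∈ T.graph.edgeSet

/-- `builtGraph σ T i` is Builder's graph after `i` rounds of strategy `σ`, if `T 0, T 1, T 2, …`
are the spanning trees offered in the first, second, third, … round. An edge which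
is already present may be selected again, and then the graph does not change. -/
def builtGraph {n : ℕ} (σ : Strategy n) (T : ℕ → SpanningTree n) : ℕ → SimpleGraph (Fin n)
  | 0 => ⊥
  | i + 1 => builtGraph σ T i ⊔
      SimpleGraph.fromEdgeSet {σ.choose (builtGraph σ T i) (T i)}

/-- The number of rounds (`⊤` if infinite) until Builder's graph first has property `P`:
the least `i ≥ 0` such that the graph after `i` rounds lies in `P`. -/
noncomputable def hittingRound {n : ℕ} (σ : Strategy n) (P : Set (SimpleGraph (Fin n)))
    (T : ℕ → SpanningTree n) : ℕ∞ :=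
  ⨅ (i : ℕ) (_ : builtGraph σ T i ∈ P), (i : ℕ∞)

/-- The law of the sequence of offered trees: independent uniform spanning trees. -/
noncomputable def treeLaw (n : ℕ) [NeZero n] : Measure (ℕ → SpanningTree n) :=
  Measure.infinitePi fun _ : ℕ => SpanningTree.uniform n

/-- The graphs on `n` vertices in which every vertex lies in a (not necessarily induced)
copy of `H`. -/
def coveredBy {V : Type*} (H : SimpleGraph V) (n : ℕ) : Set (SimpleGraph (Fin n)) :=
  {G | ∀ v : Fin n, ∃ f : SimpleGraph.Copy H G, v ∈ Set.range f}

/-! A uniform spanning tree misses a given set of `q` edges with probability at most `n / (n + q)`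
(`SpanningTree.uniform_avoiding_le`, by edge exchange). So if Builder waits for any edge of a wish
list of size `q`, the expected number of wasted rounds is at most `n / q`. For a plan of successive
steps with `q₁, q₂, …` choices, `exists_strategy_of_reaches` adds up these costs by a potential
argument and applies Markov's inequality.

It remains to find a plan of `d_min(H) n + o(n)` steps of total expected waste `o(n)`. With `D =
|V(H)| - 1`, first build, in polylogarithmically many steps, a tree-like family of cliques of depth
`D` in which every partial clique extends in `2t + 1` ways (`mem_reaches_branching`). Then give
every vertex `d_min(H)` neighbours forming a partial clique of the family, one neighbour per vertex
in each of `d_min(H)` passes (`reaches_joinedTo`). With `n - j` vertices left in a pass there are at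
least `t (n - j)` useful edges, so a pass wastes about `n log n / t` rounds, which is `o(n)` for `t`
of order `log³ n`. Completing the partial clique to `D` vertices gives a copy of `H` whose vertex of
minimum degree is the given one (`exists_copy_of_clique`).

The lower bound is the handshake lemma. -/

/-! ### Edge exchange and the probability of missing a set of edges -/

namespace SimpleGraph

/-- Remove the first edge of the tree path from `u` to `v`: the rest of the path together with the
new edge bypasses it, and the number of edges is unchanged. The removed edge contains `u`, so `w`
alone records it. -/
theorem IsTree.exists_exchange {V : Type*} [Finite V] {T : SimpleGraph V} (hT : T.IsTree) {u v : V}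
    (huv : u ≠ v) (hn : ¬ T.Adj u v) :
    ∃ w, T.Adj u w ∧ (T.deleteEdges {s(u, w)} ⊔ edge u v).IsTree := by
  obtain ⟨p, hp⟩ := (hT.connected.preconnected u v).exists_isPath
  cases p with
  | nil => exact absurd rfl huv
  | @cons _ w _ h p =>
    rw [Walk.cons_isPath_iff] at hp
    refine ⟨w, h, ?_⟩
    have hwv : w ≠ v := by rintro rfl; exact hn h
    set T' := T.deleteEdges {s(u, w)} ⊔ edge u v with hT'
    have hpe : ∀ e ∈ p.edges, e ∉ ({s(u, w)} : Set (Sym2 V)) := by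
      rintro e he rfl
      exact hp.2 (p.fst_mem_support_of_mem_edges he)
    have h1 : T'.Reachable w v :=
      ((p.toDeleteEdges _ hpe).reachable).mono le_sup_left
    have h2 : T'.Adj u v := Or.inr (by simp [edge_adj, huv])
    have h3 : T'.Reachable u w := h2.reachable.trans h1.symm
    have hconn : T'.Connected := by
      have := hT.connected.nonempty
      refine ⟨fun a b => ?_⟩
      obtain ⟨r⟩ := hT.connected.preconnected a b
      induction r with
      | nil => exact Reachable.refl _
      | @cons a c _ hac _ ih =>
        refine Reachable.trans ?_ ih
        by_cases hc : s(a, c) = s(u, w)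
        · rcases Sym2.eq_iff.1 hc with ⟨rfl, rfl⟩ | ⟨rfl, rfl⟩
          · exact h3
          · exact h3.symm
        · exact Adj.reachable (Or.inl (by simp [deleteEdges_adj, hac, hc]))
    rw [isTree_iff_connected_and_card]
    refine ⟨hconn, ?_⟩
    have hc := (isTree_iff_connected_and_card.1 hT).2
    rw [← hc]
    have hE : T'.edgeSet = insert s(u, v) (T.edgeSet \ {s(u, w)}) := by
      rw [hT', edgeSet_sup, edgeSet_deleteEdges, edgeSet_edge, Set.insert_eq, Set.union_comm]
      congr 1
      ext e
      simp only [Set.mem_sdiff, Set.mem_singleton_iff, Sym2.mem_diagSet]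
      constructor
      · exact fun h => h.1
      · rintro rfl
        exact ⟨rfl, by simpa using huv⟩
    have hfin : T.edgeSet.Finite := Set.toFinite _
    rw [Nat.card_coe_set_eq, Nat.card_coe_set_eq, hE, Set.ncard_insert_of_notMem (by simp [hn]),
      Set.ncard_sdiff_singleton_add_one (by simpa using h)]

end SimpleGraph

namespace SpanningTree

open Classical in
noncomputable instance (n : ℕ) : Fintype (SpanningTree n) := Fintype.ofFinite _

open Classical in
/-- The spanning trees that have no edge in `Q`. -/
noncomputable def avoiding {n : ℕ} (Q : Finset (Sym2 (Fin n))) : Finset (SpanningTree n) :=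
  Finset.univ.filter fun T => ∀ e ∈ Q, e ∉ T.graph.edgeSet

theorem mem_avoiding {n : ℕ} {Q : Finset (Sym2 (Fin n))} {T : SpanningTree n} :
    T ∈ avoiding Q ↔ ∀ e ∈ Q, e ∉ T.graph.edgeSet := by
  simp [avoiding]

open Classical in
/-- Deleting one more edge loses at least a fraction `1 / (n + 1)` of the trees avoiding `Q`. -/
theorem card_avoiding_insert {n : ℕ} (Q : Finset (Sym2 (Fin n))) {u v : Fin n} (huv : u ≠ v)
    (he : s(u, v) ∉ Q) :
    (n + 1) * (avoiding (insert s(u, v) Q)).card ≤ n * (avoiding Q).card := by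
  set A := avoiding (insert s(u, v) Q) with hA
  set B := (avoiding Q).filter fun T => s(u, v) ∈ T.graph.edgeSet with hB
  have hsum : A.card + B.card = (avoiding Q).card := by
    rw [← Finset.card_filter_add_card_filter_not (s := avoiding Q)
      (fun T => s(u, v) ∈ T.graph.edgeSet), add_comm]
    congr 2
    ext T
    simp only [hA, mem_avoiding, Finset.mem_filter, Finset.mem_insert, forall_eq_or_imp]
    tauto
  have hex : ∀ T ∈ A, ∃ p : SpanningTree n × Fin n, T.graph.Adj u p.2 ∧
      p.1.graph = T.graph.deleteEdges {s(u, p.2)} ⊔ SimpleGraph.edge u v := by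
    intro T hT
    have hn : ¬ T.graph.Adj u v := mem_avoiding.1 hT _ (Finset.mem_insert_self _ _)
    obtain ⟨w, hw, ht⟩ := SimpleGraph.IsTree.exists_exchange T.2 huv hn
    exact ⟨(⟨_, ht⟩, w), hw, rfl⟩
  have : NeZero n := ⟨u.pos.ne'⟩
  choose! φ hφ1 hφ2 using hex
  -- The exchange can be undone from the new tree and `w`, so `φ` is injective and `A` has at most
  -- `n` times as many trees as `B`.
  have hle : A.card ≤ (B ×ˢ (Finset.univ : Finset (Fin n))).card := by
    refine Finset.card_le_card_of_injOn φ ?_ ?_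
    · intro T hT
      have hTQ := mem_avoiding.1 hT
      simp only [Finset.coe_product, Set.mem_prod, Finset.mem_coe, Finset.mem_univ, and_true, hB,
        Finset.mem_filter, mem_avoiding, hφ2 T hT]
      refine ⟨fun e heQ hmem => ?_, by simp [huv]⟩
      rw [SimpleGraph.edgeSet_sup, SimpleGraph.edgeSet_deleteEdges, SimpleGraph.edgeSet_edge] at hmem
      rcases hmem with h | h
      · exact hTQ e (Finset.mem_insert_of_mem heQ) h.1
      · exact he (by rw [← h.1]; exact heQ)
    · intro T hT S hS h
      have key : ∀ R ∈ A, R.graph = (φ R).1.graph.deleteEdges {s(u, v)} ⊔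
          SimpleGraph.edge u (φ R).2 := by
        intro R hR
        have hn : ¬ R.graph.Adj u v := mem_avoiding.1 hR _ (Finset.mem_insert_self _ _)
        have h1 := hφ1 R hR
        rw [hφ2 R hR]
        ext a b
        simp only [SimpleGraph.sup_adj, SimpleGraph.deleteEdges_adj, SimpleGraph.edge_adj,
          Set.mem_singleton_iff, Sym2.eq_iff]
        have hs := R.graph.symm
        have hne := h1.ne
        constructor
        · intro hab
          have := hab.ne
          by_cases hc : (a = u ∧ b = (φ R).2) ∨ (a = (φ R).2 ∧ b = u)
          · exact Or.inr ⟨hc, this⟩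
          · refine Or.inl ⟨Or.inl ⟨hab, hc⟩, ?_⟩
            rintro (⟨rfl, rfl⟩ | ⟨rfl, rfl⟩)
            · exact hn hab
            · exact hn hab.symm
        · rintro (⟨⟨h, -⟩ | ⟨h, -⟩, h'⟩ | ⟨⟨rfl, rfl⟩ | ⟨rfl, rfl⟩, -⟩)
          · exact h
          · exact absurd h h'
          · exact h1
          · exact h1.symm
      apply Subtype.ext
      change T.graph = S.graph
      rw [key T hT, key S hS, h]
  rw [Finset.card_product, Finset.card_univ, Fintype.card_fin] at hle
  rw [← hsum]
  nlinarith

/-- Iterating the one-edge bound gives the factor `(n / (n + 1)) ^ q`, at most `n / (n + q)`; the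
induction step uses `n (n + q + 1) ≤ (n + q) (n + 1)`. -/
theorem card_avoiding_le {n : ℕ} (hn : 0 < n) (Q : Finset (Sym2 (Fin n)))
    (hQ : ∀ e ∈ Q, ¬ e.IsDiag) :
    (n + Q.card) * (avoiding Q).card ≤ n * Fintype.card (SpanningTree n) := by
  classical
  induction Q using Finset.induction_on with
  | empty =>
    simp only [Finset.card_empty, add_zero]
    exact Nat.mul_le_mul_left _ (Finset.card_le_univ _)
  | insert e Q he ih =>
    have ih := ih fun e h => hQ e (Finset.mem_insert_of_mem h)
    rw [Finset.card_insert_of_notMem he]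
    induction e with
    | _ u v =>
      have huv : u ≠ v := by simpa using hQ _ (Finset.mem_insert_self _ _)
      have h := card_avoiding_insert Q huv he
      refine Nat.le_of_mul_le_mul_left ?_ hn
      calc n * ((n + (Q.card + 1)) * (avoiding (insert s(u, v) Q)).card)
          ≤ (n + Q.card) * ((n + 1) * (avoiding (insert s(u, v) Q)).card) := by
            nlinarith [Nat.zero_le (Q.card * (avoiding (insert s(u, v) Q)).card)]
        _ ≤ (n + Q.card) * (n * (avoiding Q).card) := Nat.mul_le_mul_left _ h
        _ = n * ((n + Q.card) * (avoiding Q).card) := by ring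
        _ ≤ _ := Nat.mul_le_mul_left _ ih

open scoped ENNReal in
/-- A uniform spanning tree misses a set of `q` edges with probability at most `n / (n + q)`. -/
theorem uniform_avoiding_le {n : ℕ} [NeZero n] (Q : Finset (Sym2 (Fin n)))
    (hQ : ∀ e ∈ Q, ¬ e.IsDiag) :
    uniform n (avoiding Q : Set (SpanningTree n)) ≤ (n : ℝ≥0∞) / (n + Q.card : ℕ) := by
  have hn : 0 < n := Nat.pos_of_ne_zero (NeZero.ne n)
  have hc : Fintype.card (SpanningTree n) ≠ 0 := Fintype.card_ne_zero
  rw [uniform, uniformOn_univ, Measure.count_apply_finset,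
    ENNReal.div_le_iff_le_mul (Or.inl (by exact_mod_cast hc)) (Or.inl (by simp)),
    ← ENNReal.mul_div_right_comm,
    ENNReal.le_div_iff_mul_le (Or.inl (by positivity)) (Or.inl (by simp))]
  have := card_avoiding_le hn Q hQ
  rw [mul_comm] at this
  exact_mod_cast this

end SpanningTree

/-- The graphs that at least `q` edges of the complete graph bring into `P`. -/
def stepInto {n : ℕ} (q : ℕ) (P : Set (SimpleGraph (Fin n))) : Set (SimpleGraph (Fin n)) :=
  {F | ∃ Q : Finset (Sym2 (Fin n)), q ≤ Q.card ∧
    ∀ e ∈ Q, ¬ e.IsDiag ∧ F ⊔ SimpleGraph.fromEdgeSet {e} ∈ P}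

theorem IsUpperSet.stepInto {n q : ℕ} {P : Set (SimpleGraph (Fin n))} (hP : IsUpperSet P) :
    IsUpperSet (stepInto q P) := by
  rintro F F' hF ⟨Q, hq, hQ⟩
  exact ⟨Q, hq, fun e he => ⟨(hQ e he).1, hP (sup_le_sup_right hF _) (hQ e he).2⟩⟩

theorem SpanningTree.edgeSet_nonempty {n : ℕ} (hn : 2 ≤ n) (T : SpanningTree n) :
    T.graph.edgeSet.Nonempty := by
  have : Nontrivial (Fin n) := Fin.nontrivial_iff_two_le.2 hn
  obtain ⟨w, hw⟩ := T.2.connected.preconnected.exists_adj_of_nontrivial ⟨0, by omega⟩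
  exact ⟨s(_, w), hw⟩

/-! ### Independence of the offered tree from the past -/

section Independence

open scoped ENNReal

variable {n : ℕ}

theorem builtGraph_congr (σ : Strategy n) {T T' : ℕ → SpanningTree n} {t : ℕ}
    (h : ∀ i < t, T i = T' i) : builtGraph σ T t = builtGraph σ T' t := by
  induction t with
  | zero => rfl
  | succ t ih =>
    simp only [builtGraph]
    rw [ih fun i hi => h i (by omega), h t (by omega)]

theorem exists_builtGraph_eq_restrict [NeZero n] (σ : Strategy n) (t : ℕ) :
    ∃ γ : ((Finset.range t) → SpanningTree n) → SimpleGraph (Fin n),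
      ∀ T : ℕ → SpanningTree n, builtGraph σ T t = γ fun i => T i := by
  -- The default tree is never read: only trees of index below `t` matter. The finitely many
  -- coordinates form a countable discrete space, which later settles measurability.
  refine ⟨fun y => builtGraph σ
    (fun i => if h : i ∈ Finset.range t then y ⟨i, h⟩ else Classical.arbitrary _) t, fun T => ?_⟩
  refine builtGraph_congr σ fun i hi => ?_
  simp [hi]

theorem measurable_builtGraph_comp [NeZero n] (σ : Strategy n) (t : ℕ)
    (φ : SimpleGraph (Fin n) → SpanningTree n → ℝ≥0∞) :
    Measurable fun T : ℕ → SpanningTree n => φ (builtGraph σ T t) (T t) := by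
  obtain ⟨γ, hγ⟩ := exists_builtGraph_eq_restrict σ t
  simp only [hγ]
  have h : Measurable fun p : ((Finset.range t) → SpanningTree n) × SpanningTree n =>
      φ (γ p.1) p.2 := measurable_of_countable _
  exact h.comp (by fun_prop : Measurable fun T : ℕ → SpanningTree n =>
    ((fun i : Finset.range t => T i), T t))

/-- The tree offered in a round is independent of the graph built before that round. -/
theorem lintegral_builtGraph [NeZero n] (σ : Strategy n) (t : ℕ)
    (φ : SimpleGraph (Fin n) → SpanningTree n → ℝ≥0∞) :
    ∫⁻ T, φ (builtGraph σ T t) (T t) ∂treeLaw n =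
      ∫⁻ T, ∫⁻ τ, φ (builtGraph σ T t) τ ∂SpanningTree.uniform n ∂treeLaw n := by
  obtain ⟨γ, hγ⟩ := exists_builtGraph_eq_restrict σ t
  simp only [hγ]
  have : IsProbabilityMeasure (treeLaw n) := by unfold treeLaw; infer_instance
  have hind : IndepFun (fun (T : ℕ → SpanningTree n) (i : Finset.range t) => T i)
      (fun T => T t) (treeLaw n) := by
    have h1 : iIndepFun (fun (i : ℕ) (T : ℕ → SpanningTree n) => T i) (treeLaw n) :=
      iIndepFun_infinitePi (X := fun _ ω => ω) (by fun_prop)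
    have h2 := h1.indepFun_finset (Finset.range t) {t} (by simp) (by fun_prop)
    exact h2.comp (ψ := fun y : ({t} : Finset ℕ) → SpanningTree n => y ⟨t, by simp⟩)
      measurable_id (measurable_pi_apply _)
  have hmap : (treeLaw n).map (fun T => T t) = SpanningTree.uniform n :=
    Measure.infinitePi_map_eval _ t
  have hr : Measurable fun (T : ℕ → SpanningTree n) (i : Finset.range t) => T i := by fun_prop
  have he : Measurable fun T : ℕ → SpanningTree n => T t := measurable_pi_apply t
  have hprod := (indepFun_iff_map_prod_eq_prod_map_map hr.aemeasurable he.aemeasurable).1 hind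
  rw [hmap] at hprod
  have hm : Measurable fun p : ((Finset.range t) → SpanningTree n) × SpanningTree n =>
      φ (γ p.1) p.2 := measurable_of_countable _
  calc ∫⁻ T, φ (γ fun i => T i) (T t) ∂treeLaw n
      = ∫⁻ p, φ (γ p.1) p.2 ∂((treeLaw n).map
          fun T => ((fun i : Finset.range t => T i), T t)) := by
        rw [lintegral_map hm (by fun_prop)]
    _ = ∫⁻ y, ∫⁻ τ, φ (γ y) τ ∂SpanningTree.uniform n ∂((treeLaw n).map
          fun (T : ℕ → SpanningTree n) (i : Finset.range t) => T i) := by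
        have : IsProbabilityMeasure ((treeLaw n).map
          fun (T : ℕ → SpanningTree n) (i : Finset.range t) => T i) :=
          Measure.isProbabilityMeasure_map hr.aemeasurable
        rw [hprod, lintegral_prod _ hm.aemeasurable]
    _ = _ := by
        rw [lintegral_map (measurable_of_countable _) (by fun_prop)]

end Independence

open scoped ENNReal in
-- A failed round costs itself plus the budget `n / q` that is still unspent; weighted by the
-- failure probability, this is covered by `n / q`, with equality at `w = q > 0`.
theorem one_add_div_mul_div_le {n q w : ℕ} (hn : 0 < n) (hqw : q ≤ w) :
    (1 + (n : ℝ≥0∞) / q) * ((n : ℝ≥0∞) / (n + w : ℕ)) ≤ (n : ℝ≥0∞) / q := by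
  rcases Nat.eq_zero_or_pos q with rfl | hq
  · rw [Nat.cast_zero, ENNReal.div_zero (by exact_mod_cast hn.ne')]
    exact le_top
  have hq0 : (q : ℝ≥0∞) ≠ 0 := by exact_mod_cast hq.ne'
  calc (1 + (n : ℝ≥0∞) / q) * ((n : ℝ≥0∞) / (n + w : ℕ))
      ≤ (1 + (n : ℝ≥0∞) / q) * ((n : ℝ≥0∞) / (n + q : ℕ)) := by gcongr
    _ = ((n + q : ℕ) : ℝ≥0∞) / q * ((n : ℝ≥0∞) / (n + q : ℕ)) := by
        rw [Nat.cast_add, ENNReal.add_div, ENNReal.div_self hq0 (by simp), add_comm]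
    _ = ((n + q : ℕ) : ℝ≥0∞) * ((n + q : ℕ) : ℝ≥0∞)⁻¹ * ((n : ℝ≥0∞) / q) := by
        simp only [div_eq_mul_inv]; ring
    _ = (n : ℝ≥0∞) / q := by
        rw [ENNReal.mul_inv_cancel (by exact_mod_cast (by omega)) (by simp), one_mul]

/-! ### From plans with many choices to strategies with few wasted rounds -/

section Chain

open scoped ENNReal

variable {n : ℕ}

/-- A strategy, given a wish list for every graph: select an edge of the wish list whenever the
offered tree has one. -/
theorem exists_strategy_of_wish (hn : 2 ≤ n) (W : SimpleGraph (Fin n) → Finset (Sym2 (Fin n))) :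
    ∃ σ : Strategy n, ∀ F T, T ∉ SpanningTree.avoiding (W F) → σ.choose F T ∈ W F := by
  have h : ∀ (F : SimpleGraph (Fin n)) (T : SpanningTree n), ∃ e ∈ T.graph.edgeSet,
      T ∉ SpanningTree.avoiding (W F) → e ∈ W F := by
    intro F T
    by_cases hT : T ∈ SpanningTree.avoiding (W F)
    · obtain ⟨e, he⟩ := SpanningTree.edgeSet_nonempty hn T
      exact ⟨e, he, fun h => absurd hT h⟩
    · have hT' := hT
      rw [SpanningTree.mem_avoiding] at hT'
      push Not at hT'
      obtain ⟨e, he, he'⟩ := hT'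
      exact ⟨e, he', fun _ => he⟩
  choose c hc hc' using h
  exact ⟨⟨c, hc⟩, hc'⟩

open Classical in
/-- If every graph `F` has a rank at most `K`, the rank is monotone, and at rank `j < K` at least
`q j` edges increase it, then Builder reaches rank `K` with few wasted rounds. -/
theorem exists_strategy_of_rank [NeZero n] (hn : 2 ≤ n) (K : ℕ) (q : ℕ → ℕ)
    (rank : SimpleGraph (Fin n) → ℕ) (hmono : Monotone rank) (hK : ∀ F, rank F ≤ K)
    (hq : ∀ F, rank F < K → ∃ Q : Finset (Sym2 (Fin n)), q (rank F) ≤ Q.card ∧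
      ∀ e ∈ Q, ¬ e.IsDiag ∧ rank F < rank (F ⊔ SimpleGraph.fromEdgeSet {e})) :
    ∃ σ : Strategy n, ∀ t : ℕ,
      treeLaw n {T | rank (builtGraph σ T (K + t)) < K} ≤
        (∑ j ∈ Finset.range K, (n : ℝ≥0∞) / q j) / (t + 1 : ℕ) := by
  choose! W hW1 hW2 using hq
  obtain ⟨σ, hσ⟩ := exists_strategy_of_wish hn W
  refine ⟨σ, fun t => ?_⟩
  -- The potential `g j` is the budget for failures still to come at rank `j`. Failures so far plus
  -- potential have nonincreasing expectation.
  set g : ℕ → ℝ≥0∞ := fun j => ∑ i ∈ Finset.Ico j K, (n : ℝ≥0∞) / q i with hg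
  have hganti : Antitone g := fun a b hab =>
    Finset.sum_le_sum_of_subset (Finset.Ico_subset_Ico_left hab)
  set fail : SimpleGraph (Fin n) → SpanningTree n → ℝ≥0∞ := fun F τ =>
    if rank F < K ∧ τ ∈ SpanningTree.avoiding (W F) then 1 else 0 with hfail
  set next : SimpleGraph (Fin n) → SpanningTree n → SimpleGraph (Fin n) := fun F τ =>
    F ⊔ SimpleGraph.fromEdgeSet {σ.choose F τ} with hnext
  have hnextle : ∀ F τ, rank F ≤ rank (next F τ) := fun F τ => hmono le_sup_left
  have hsucc : ∀ F τ, rank F < K → τ ∉ SpanningTree.avoiding (W F) →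
      rank F + 1 ≤ rank (next F τ) := fun F τ hF hτ => (hW2 F hF _ (hσ F τ hτ)).2
  have hstep : ∀ F, ∫⁻ τ, fail F τ + g (rank (next F τ)) ∂SpanningTree.uniform n
      ≤ g (rank F) := by
    intro F
    by_cases hF : rank F < K
    · set A := SpanningTree.avoiding (W F) with hA
      have hgsucc : g (rank F) = n / q (rank F) + g (rank F + 1) := by
        simp only [hg]
        rw [Finset.sum_eq_sum_Ico_succ_bot hF]
      calc ∫⁻ τ, fail F τ + g (rank (next F τ)) ∂SpanningTree.uniform n
          ≤ ∫⁻ τ, g (rank F + 1) + (A : Set (SpanningTree n)).indicator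
              (fun _ => 1 + (n : ℝ≥0∞) / q (rank F)) τ ∂SpanningTree.uniform n := by
            refine lintegral_mono fun τ => ?_
            by_cases hτ : τ ∈ A
            · have h1 : fail F τ = 1 := if_pos ⟨hF, hτ⟩
              simp only [h1, hτ, Set.indicator, Finset.mem_coe, if_true]
              calc _ ≤ 1 + g (rank F) := by gcongr; exact hganti (hnextle F τ)
                _ = _ := by rw [hgsucc]; ring
            · have h0 : fail F τ = 0 := if_neg fun h => hτ h.2
              simp only [h0, hτ, Set.indicator, Finset.mem_coe, if_false, zero_add, add_zero]
              exact hganti (hsucc F τ hF hτ)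
        _ = g (rank F + 1) + (1 + (n : ℝ≥0∞) / q (rank F)) *
              SpanningTree.uniform n (A : Set (SpanningTree n)) := by
            rw [lintegral_add_left measurable_const, lintegral_indicator (by measurability)]
            simp
        _ ≤ g (rank F + 1) + (1 + (n : ℝ≥0∞) / q (rank F)) * ((n : ℝ≥0∞) / (n + (W F).card : ℕ)) := by
            gcongr
            exact SpanningTree.uniform_avoiding_le _ fun e he => (hW2 F hF e he).1
        _ ≤ g (rank F + 1) + (n : ℝ≥0∞) / q (rank F) := by
            gcongr
            exact one_add_div_mul_div_le (by omega) (hW1 F hF)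
        _ = g (rank F) := by rw [hgsucc, add_comm]
    · have hFK : rank F = K := le_antisymm (hK F) (not_lt.1 hF)
      have hz : ∀ τ, fail F τ + g (rank (next F τ)) = 0 := by
        intro τ
        have : rank (next F τ) = K := le_antisymm (hK _) (hFK ▸ hnextle F τ)
        simp [hfail, hF, hg, this]
      simp [hz]
  set X : ℕ → (ℕ → SpanningTree n) → ℝ≥0∞ := fun t T =>
    ∑ s ∈ Finset.range t, fail (builtGraph σ T s) (T s) with hX
  have hXm : ∀ t, Measurable (X t) := fun t =>
    Finset.measurable_fun_sum _ fun s _ => measurable_builtGraph_comp σ s fail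
  have hsuper : ∀ t, ∫⁻ T, X t T + g (rank (builtGraph σ T t)) ∂treeLaw n ≤ g 0 := by
    intro t
    have : IsProbabilityMeasure (treeLaw n) := by unfold treeLaw; infer_instance
    induction t with
    | zero =>
      calc _ ≤ ∫⁻ _, g 0 ∂treeLaw n := by
            refine lintegral_mono fun T => ?_
            simp only [hX, Finset.range_zero, Finset.sum_empty, zero_add]
            exact hganti (Nat.zero_le _)
        _ = g 0 := by simp
    | succ t ih =>
      refine le_trans ?_ ih
      have h1 : ∀ T, X (t + 1) T + g (rank (builtGraph σ T (t + 1))) =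
          X t T + (fail (builtGraph σ T t) (T t) + g (rank (next (builtGraph σ T t) (T t)))) := by
        intro T
        simp only [hX, Finset.sum_range_succ, add_assoc]
        rfl
      simp only [h1]
      rw [lintegral_add_left (hXm t), lintegral_add_left (hXm t),
        lintegral_builtGraph σ t fun F τ => fail F τ + g (rank (next F τ))]
      gcongr with T
      exact hstep _
  -- Below rank `K`, every round raises the rank or is a failure. So being below `K` after `K + t`
  -- rounds forces `t + 1` failures, and Markov's inequality applies.
  have hcount : ∀ T t, rank (builtGraph σ T t) < K →
      (t : ℝ≥0∞) ≤ rank (builtGraph σ T t) + X t T := by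
    intro T t
    induction t with
    | zero => intro _; simp
    | succ t ih =>
      intro hlt
      have hle := hnextle (builtGraph σ T t) (T t)
      have hlt' : rank (builtGraph σ T t) < K := lt_of_le_of_lt hle hlt
      have ih := ih hlt'
      have hXs : X (t + 1) T = X t T + fail (builtGraph σ T t) (T t) := by
        simp only [hX, Finset.sum_range_succ]
      rw [hXs]
      by_cases hτ : T t ∈ SpanningTree.avoiding (W (builtGraph σ T t))
      · have : fail (builtGraph σ T t) (T t) = 1 := by simp [hfail, hlt', hτ]
        rw [this, Nat.cast_succ, ← add_assoc]
        gcongr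
        refine ih.trans ?_
        gcongr
        exact hle
      · have hs := hsucc _ _ hlt' hτ
        calc ((t + 1 : ℕ) : ℝ≥0∞) ≤ (rank (builtGraph σ T t) + X t T) + 1 := by
              push_cast; gcongr
          _ = ((rank (builtGraph σ T t) + 1 : ℕ) : ℝ≥0∞) + X t T := by push_cast; ring
          _ ≤ rank (builtGraph σ T (t + 1)) + (X t T + fail (builtGraph σ T t) (T t)) := by
              gcongr
              · exact hs
              · exact le_self_add
  have hsub : {T | rank (builtGraph σ T (K + t)) < K} ⊆ {T | ((t + 1 : ℕ) : ℝ≥0∞) ≤ X (K + t) T} := by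
    intro T hT
    have h := hcount T (K + t) hT
    have hT' : rank (builtGraph σ T (K + t)) + 1 ≤ K := hT
    have h2 : ((rank (builtGraph σ T (K + t)) : ℕ) : ℝ≥0∞) + (t + 1 : ℕ) ≤
        rank (builtGraph σ T (K + t)) + X (K + t) T := by
      refine le_trans ?_ h
      norm_cast
      omega
    exact (ENNReal.add_le_add_iff_left (by simp)).1 h2
  rw [ENNReal.le_div_iff_mul_le (Or.inl (by simp)) (Or.inl (by simp)), mul_comm]
  calc ((t + 1 : ℕ) : ℝ≥0∞) * treeLaw n {T | rank (builtGraph σ T (K + t)) < K}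
      ≤ ((t + 1 : ℕ) : ℝ≥0∞) * treeLaw n {T | ((t + 1 : ℕ) : ℝ≥0∞) ≤ X (K + t) T} := by
        gcongr
    _ ≤ ∫⁻ T, X (K + t) T ∂treeLaw n := mul_meas_ge_le_lintegral (hXm _) _
    _ ≤ ∫⁻ T, X (K + t) T + g (rank (builtGraph σ T (K + t))) ∂treeLaw n :=
        lintegral_mono fun T => le_self_add
    _ ≤ g 0 := hsuper _
    _ = _ := by simp only [hg, Finset.range_eq_Ico]

/-- The graphs from which `P` is reached by successive steps that have at least
`q₁, q₂, …` choices. -/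
def reaches (P : Set (SimpleGraph (Fin n))) : List ℕ → Set (SimpleGraph (Fin n))
  | [] => P
  | q :: qs => stepInto q (reaches P qs)

theorem IsUpperSet.reaches {P : Set (SimpleGraph (Fin n))} (hP : IsUpperSet P) {qs : List ℕ} :
    IsUpperSet (reaches P qs) := by
  induction qs with
  | nil => exact hP
  | cons q qs ih => exact ih.stepInto

open Classical in
theorem exists_strategy_of_reaches [NeZero n] (hn : 2 ≤ n) {P : Set (SimpleGraph (Fin n))}
    (hP : IsUpperSet P) (qs : List ℕ) (h : ⊥ ∈ reaches P qs) :
    ∃ σ : Strategy n, ∀ t : ℕ,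
      treeLaw n {T | builtGraph σ T (qs.length + t) ∉ P} ≤
        (qs.map fun q : ℕ => (n : ℝ≥0∞) / q).sum / (t + 1 : ℕ) := by
  have hup := fun qs => hP.reaches (qs := qs)
  -- The rank is the largest number of initial steps of the plan that can be skipped; a single edge
  -- may raise it by more than one.
  set rank : SimpleGraph (Fin n) → ℕ := fun F =>
    Nat.findGreatest (fun j => F ∈ reaches P (qs.drop j)) qs.length with hrank
  have hspec : ∀ F, F ∈ reaches P (qs.drop (rank F)) := fun F =>
    Nat.findGreatest_spec (P := fun j => F ∈ reaches P (qs.drop j)) (Nat.zero_le _)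
      (hup _ bot_le h)
  obtain ⟨σ, hσ⟩ := exists_strategy_of_rank hn qs.length (fun j => qs.getD j 0) rank
    (fun F F' hF => Nat.findGreatest_mono_left (fun j hj => hup _ hF hj) _)
    (fun F => Nat.findGreatest_le _) (fun F hF => by
      have hF' := hspec F
      rw [List.drop_eq_getElem_cons hF] at hF'
      obtain ⟨Q, hQ, hQ'⟩ := hF'
      refine ⟨Q, by simpa [hF] using hQ, fun e he => ⟨(hQ' e he).1, ?_⟩⟩
      exact Nat.le_findGreatest (P := fun j => _ ∈ reaches P (qs.drop j)) hF (hQ' e he).2)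
  refine ⟨σ, fun t => le_trans (measure_mono fun T hT => ?_) ((hσ t).trans_eq ?_)⟩
  · refine lt_of_le_of_ne (Nat.findGreatest_le _) fun heq => hT ?_
    have := hspec (builtGraph σ T (qs.length + t))
    rw [show rank (builtGraph σ T (qs.length + t)) = qs.length from heq] at this
    simpa [reaches] using this
  · congr 1
    rw [← Fin.sum_univ_eq_sum_range (fun j => (n : ℝ≥0∞) / (qs.getD j 0 : ℕ)), ← List.sum_ofFn]
    congr 1
    refine List.ext_getElem (by simp) fun i h1 h2 => ?_
    have : i < qs.length := by simpa using h1
    simp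

end Chain

/-! ### Composing plans -/

section Reaches

variable {n : ℕ}

theorem reaches_mono {P P' : Set (SimpleGraph (Fin n))} (h : P ⊆ P') (qs : List ℕ) :
    reaches P qs ⊆ reaches P' qs := by
  induction qs with
  | nil => exact h
  | cons q qs ih =>
    rintro F ⟨Q, hq, hQ⟩
    exact ⟨Q, hq, fun e he => ⟨(hQ e he).1, ih (hQ e he).2⟩⟩

theorem reaches_append (P : Set (SimpleGraph (Fin n))) (qs qs' : List ℕ) :
    reaches P (qs ++ qs') = reaches (reaches P qs') qs := by
  induction qs with
  | nil => rfl
  | cons q qs ih => simp only [List.cons_append, reaches, ih]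

/-- Steps only add edges. This keeps the results of earlier stages available when plans are
concatenated. -/
theorem reaches_inter_Ici {P : Set (SimpleGraph (Fin n))} {qs : List ℕ} {F₀ F : SimpleGraph (Fin n)}
    (h : F ∈ reaches P qs) (hF : F₀ ≤ F) : F ∈ reaches (P ∩ Set.Ici F₀) qs := by
  induction qs generalizing F with
  | nil => exact ⟨h, hF⟩
  | cons q qs ih =>
    obtain ⟨Q, hq, hQ⟩ := h
    exact ⟨Q, hq, fun e he => ⟨(hQ e he).1, ih (hQ e he).2 (hF.trans le_sup_left)⟩⟩

theorem reaches_flatMap_range {P : ℕ → Set (SimpleGraph (Fin n))} {l : ℕ → List ℕ} {b : ℕ}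
    (h : ∀ j < b, P j ⊆ reaches (P (j + 1)) (l j)) :
    P 0 ⊆ reaches (P b) ((List.range b).flatMap l) := by
  induction b with
  | zero => exact subset_rfl
  | succ b ih =>
    rw [List.range_succ, List.flatMap_append, reaches_append]
    refine (ih fun j hj => h j (by omega)).trans (reaches_mono ?_ _)
    simpa using h b (by omega)

theorem adj_sup_fromEdgeSet (F : SimpleGraph (Fin n)) {u v : Fin n} (h : u ≠ v) :
    (F ⊔ SimpleGraph.fromEdgeSet {s(u, v)}).Adj u v := by
  simp [h]

/-- Joining `x` to `b` vertices of `A`. -/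
theorem mem_reaches_star {x : Fin n} {A : Finset (Fin n)} (hx : x ∉ A) {b q : ℕ}
    (hq : b + q ≤ A.card + 1) (F : SimpleGraph (Fin n)) :
    F ∈ reaches {F | ∃ Y ⊆ A, Y.card = b ∧ ∀ y ∈ Y, F.Adj x y}
      ((List.range b).flatMap fun _ => [q]) := by
  refine reaches_flatMap_range (P := fun j => {F | ∃ Y ⊆ A, Y.card = j ∧ ∀ y ∈ Y, F.Adj x y})
    ?_ ⟨∅, by simp, by simp, by simp⟩
  rintro j hj F ⟨Y, hYA, hY, hadj⟩
  -- At most `b - 1` vertices of `A` are used before a step, whence the `+ 1` in `hq`.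
  refine ⟨(A \ Y).image fun y => s(x, y), ?_, fun e he => ?_⟩
  · rw [Finset.card_image_of_injective _ fun a b h => Sym2.congr_right.1 h,
      Finset.card_sdiff_of_subset hYA]
    omega
  · obtain ⟨y, hy, rfl⟩ := Finset.mem_image.1 he
    rw [Finset.mem_sdiff] at hy
    have hxy : x ≠ y := by rintro rfl; exact hx hy.1
    refine ⟨by simpa using hxy, insert y Y, ?_, ?_, ?_⟩
    · exact Finset.insert_subset hy.1 hYA
    · rw [Finset.card_insert_of_notMem hy.2, hY]
    · intro z hz
      rcases Finset.mem_insert.1 hz with rfl | hz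
      · exact adj_sup_fromEdgeSet F hxy
      · exact Or.inl (hadj z hz)

end Reaches

/-! ### Branching cliques and joining the vertices to them -/

section Branching

variable {n : ℕ}

/-- `C` is a clique, extendable `i` times by a vertex with `M` choices each time. -/
def Branching (M : ℕ) (F : SimpleGraph (Fin n)) : ℕ → Finset (Fin n) → Prop
  | 0, C => F.IsClique C
  | i + 1, C => ∃ X : Finset (Fin n), X.card = M ∧ ∀ x ∈ X, x ∉ C ∧ Branching M F i (insert x C)

theorem Branching.mono {M : ℕ} {F F' : SimpleGraph (Fin n)} (hF : F ≤ F') {i : ℕ}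
    {C : Finset (Fin n)} (h : Branching M F i C) : Branching M F' i C := by
  induction i generalizing C with
  | zero => exact SimpleGraph.IsClique.mono hF h
  | succ i ih =>
    obtain ⟨X, hX, h⟩ := h
    exact ⟨X, hX, fun x hx => ⟨(h x hx).1, ih (h x hx).2⟩⟩

/-- Of two choices at each level, at least one differs from `v`. -/
theorem Branching.exists_clique {M : ℕ} (hM : 2 ≤ M) {F : SimpleGraph (Fin n)} {i : ℕ}
    {C : Finset (Fin n)} (h : Branching M F i C) {v : Fin n} (hv : v ∉ C) :
    ∃ C', C ⊆ C' ∧ C'.card = C.card + i ∧ F.IsClique C' ∧ v ∉ C' := by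
  induction i generalizing C with
  | zero => exact ⟨C, subset_rfl, rfl, h, hv⟩
  | succ i ih =>
    obtain ⟨X, hX, h⟩ := h
    obtain ⟨x, hx, hxv⟩ := Finset.exists_mem_ne (by omega : 1 < X.card) v
    obtain ⟨C', h1, h2, h3⟩ := ih (h x hx).2 (by simp [hv, hxv.symm])
    rw [Finset.card_insert_of_notMem (h x hx).1] at h2
    exact ⟨C', (Finset.subset_insert _ _).trans h1, by omega, h3⟩

/-- The numbers of choices in the steps that build a branching clique of depth `i` among
`L ^ i` vertices. -/
def buildList (M L : ℕ) : ℕ → List ℕ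
  | 0 => []
  | i + 1 => (List.range M).flatMap fun _ =>
      ((List.range (L ^ i)).flatMap fun _ => [L ^ (i + 1) - L ^ i]) ++ buildList M L i

/-- `A` is a pool of common neighbours of `C`. For each of `M` vertices `x` of the pool, join `x` to
`L ^ i` others; these form a pool for `insert x C`, and the construction recurses. Pools of
different `x` may overlap, since added edges do no harm. -/
theorem mem_reaches_branching {M L : ℕ} (hL : 0 < L) (hML : M ≤ L) (i : ℕ)
    {F : SimpleGraph (Fin n)} {C A : Finset (Fin n)} (hC : F.IsClique C) (hA : L ^ i ≤ A.card)
    (hAC : ∀ a ∈ A, ∀ c ∈ C, F.Adj a c) :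
    F ∈ reaches {F | Branching M F i C} (buildList M L i) := by
  induction i generalizing F C A with
  | zero => exact hC
  | succ i ih =>
    have hnot : ∀ a ∈ A, a ∉ C := fun a ha hc => (hAC a ha a hc).ne rfl
    refine reaches_mono (P := {F' | F ≤ F' ∧ ∃ X ⊆ A, X.card = M ∧
      ∀ x ∈ X, Branching M F' i (insert x C)}) ?_ _ (reaches_flatMap_range
        (P := fun j => {F' | F ≤ F' ∧ ∃ X ⊆ A, X.card = j ∧
          ∀ x ∈ X, Branching M F' i (insert x C)}) ?_ ⟨le_rfl, ∅, by simp⟩)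
    · rintro F' ⟨-, X, hXA, hX, h⟩
      exact ⟨X, hX, fun x hx => ⟨hnot x (hXA hx), h x hx⟩⟩
    rintro j hj F₁ ⟨hF₁, X, hXA, hX, hbr⟩
    have hLi : L ^ i ≤ L ^ (i + 1) := Nat.pow_le_pow_right hL (by omega)
    have hLi' : L ≤ L ^ (i + 1) := Nat.le_self_pow (by omega) L
    obtain ⟨x, hxA, hxX⟩ : ∃ x ∈ A, x ∉ X :=
      Finset.exists_mem_notMem_of_card_lt_card (by omega)
    rw [reaches_append]
    have hstar := reaches_inter_Ici (mem_reaches_star (x := x) (A := A.erase x)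
      (b := L ^ i) (q := L ^ (i + 1) - L ^ i) (by simp)
      (by rw [Finset.card_erase_of_mem hxA]; omega) F₁) le_rfl
    refine reaches_mono ?_ _ hstar
    rintro F₂ ⟨⟨Y, hYA, hY, hadj⟩, hF₂⟩
    have hF₂' : F ≤ F₂ := hF₁.trans hF₂
    have hclique : F₂.IsClique (insert x C : Finset (Fin n)) := by
      rw [Finset.coe_insert, SimpleGraph.isClique_insert]
      exact ⟨hC.mono hF₂', fun b hb _ => hF₂' (hAC x hxA b hb)⟩
    have hmem := ih (A := Y) hclique hY.ge fun a ha c hc => by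
      rcases Finset.mem_insert.1 hc with rfl | hc
      · exact (hadj a ha).symm
      · exact hF₂' (hAC a (Finset.mem_of_mem_erase (hYA ha)) c hc)
    refine reaches_mono ?_ _ (reaches_inter_Ici hmem le_rfl)
    rintro F₃ ⟨hF₃, hF₃'⟩
    have hF₃' : F₂ ≤ F₃ := hF₃'
    refine ⟨hF₂'.trans hF₃', insert x X, Finset.insert_subset hxA hXA,
      by rw [Finset.card_insert_of_notMem hxX, hX], fun y hy => ?_⟩
    rcases Finset.mem_insert.1 hy with rfl | hy
    · exact hF₃
    · exact (hbr y hy).mono (le_trans hF₂ hF₃')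

/-- `v` is joined to a clique of `l` vertices that branches `i` more times. -/
def JoinedTo (M : ℕ) (F : SimpleGraph (Fin n)) (i l : ℕ) (v : Fin n) : Prop :=
  ∃ C : Finset (Fin n), C.card = l ∧ Branching M F i C ∧ ∀ c ∈ C, F.Adj v c

theorem JoinedTo.mono {M : ℕ} {F F' : SimpleGraph (Fin n)} (hF : F ≤ F') {i l : ℕ} {v : Fin n}
    (h : JoinedTo M F i l v) : JoinedTo M F' i l v := by
  obtain ⟨C, h1, h2, h3⟩ := h
  exact ⟨C, h1, h2.mono hF, fun c hc => hF (h3 c hc)⟩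

/-- An edge may be useful to both its ends. This double counting is why the branching number is
about `2 * t` for `t` choices. -/
theorem card_sigma_le_two_mul_card_image {α : Type*} [DecidableEq α]
    (s : Finset ((_ : α) × α)) :
    s.card ≤ 2 * (s.image fun p => s(p.1, p.2)).card := by
  refine Finset.card_le_mul_card_image s 2 fun e _ => ?_
  induction e with
  | _ a b =>
    refine (Finset.card_le_card (t := {⟨a, b⟩, ⟨b, a⟩}) ?_).trans Finset.card_le_two
    rintro ⟨c, d⟩ h
    have h := (Finset.mem_filter.1 h).2
    rcases Sym2.eq_iff.1 h with ⟨h1, h2⟩ | ⟨h1, h2⟩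
    · dsimp at h1 h2; subst h1 h2; simp
    · dsimp at h1 h2; subst h1 h2; simp

/-- The numbers of choices in the steps that give every vertex one more neighbour. -/
def joinList (t n : ℕ) : List ℕ := (List.range n).flatMap fun j => [t * (n - j)]

/-- Each untreated `v` may be joined to any of the `2 * t + 1` vertices extending its clique, except
possibly `v` itself. With `j` vertices treated this gives at least `2 * t * (n - j)` ordered pairs,
hence `t * (n - j)` edges. -/
theorem reaches_joinedTo (t i l : ℕ) :
    {F : SimpleGraph (Fin n) | ∀ v, JoinedTo (2 * t + 1) F (i + 1) l v} ⊆
      reaches {F | ∀ v, JoinedTo (2 * t + 1) F i (l + 1) v} (joinList t n) := by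
  classical
  intro F hF
  refine reaches_mono (P := {F | (∀ v, JoinedTo (2 * t + 1) F (i + 1) l v) ∧
      ∃ B : Finset (Fin n), B.card = n ∧ ∀ v ∈ B, JoinedTo (2 * t + 1) F i (l + 1) v}) ?_ _
    (reaches_flatMap_range (P := fun j => {F | (∀ v, JoinedTo (2 * t + 1) F (i + 1) l v) ∧
      ∃ B : Finset (Fin n), B.card = j ∧ ∀ v ∈ B, JoinedTo (2 * t + 1) F i (l + 1) v})
      ?_ ⟨hF, ∅, by simp⟩)
  · rintro F' ⟨-, B, hB, h⟩ v
    refine h v ?_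
    rw [(Finset.card_eq_iff_eq_univ B).1 (by simpa using hB)]
    exact Finset.mem_univ v
  clear hF F
  rintro j hj F ⟨hF, B, hB, hBJ⟩
  choose C hCl hCb hCadj using hF
  choose X hX hXC using hCb
  refine ⟨(Bᶜ.sigma fun v => (X v).erase v).image fun p => s(p.1, p.2), ?_, fun e he => ?_⟩
  · have h1 : Bᶜ.card * (2 * t) ≤ (Bᶜ.sigma fun v => (X v).erase v).card := by
      rw [Finset.card_sigma, ← smul_eq_mul]
      refine Finset.card_nsmul_le_sum _ _ _ fun v _ => ?_
      have := Finset.pred_card_le_card_erase (s := X v) (a := v)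
      rw [hX v] at this
      simpa using this
    have h2 := card_sigma_le_two_mul_card_image (Bᶜ.sigma fun v => (X v).erase v)
    rw [Finset.card_compl, Fintype.card_fin, hB] at h1
    have h3 : (n - j) * (2 * t) = 2 * (t * (n - j)) := by ring
    omega
  · obtain ⟨⟨v, x⟩, hp, rfl⟩ := Finset.mem_image.1 he
    rw [Finset.mem_sigma, Finset.mem_compl, Finset.mem_erase] at hp
    obtain ⟨hv, hxv, hx⟩ := hp
    dsimp only at hv hxv hx ⊢
    refine ⟨by simpa using hxv.symm, fun w => ?_, insert v B, ?_, fun w hw => ?_⟩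
    · exact JoinedTo.mono le_sup_left ⟨C w, hCl w, ⟨X w, hX w, hXC w⟩, hCadj w⟩
    · rw [Finset.card_insert_of_notMem hv, hB]
    · rcases Finset.mem_insert.1 hw with rfl | hw
      · refine ⟨insert x (C w), ?_, (hXC w x hx).2.mono le_sup_left, fun c hc => ?_⟩
        · rw [Finset.card_insert_of_notMem (hXC w x hx).1, hCl w]
        · rcases Finset.mem_insert.1 hc with rfl | hc
          · exact adj_sup_fromEdgeSet F hxv.symm
          · exact Or.inl (hCadj w c hc)
      · exact (hBJ w hw).mono le_sup_left

end Branching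

/-! ### From joined cliques to copies of `H` -/

section Copies

variable {n : ℕ} {V : Type*}

/-- A vertex joined to `deg u` vertices of a clique on `|V(H)| - 1` other vertices plays the role
of `u` in a copy of `H`. -/
theorem exists_copy_of_clique [Fintype V] (H : SimpleGraph V) [DecidableRel H.Adj] (u : V)
    {F : SimpleGraph (Fin n)} {v : Fin n} {C C' : Finset (Fin n)} (hCC' : C ⊆ C')
    (hC : C.card = H.degree u) (hC' : C'.card + 1 = Fintype.card V) (hclique : F.IsClique C')
    (hv : v ∉ C') (hadj : ∀ c ∈ C, F.Adj v c) :
    ∃ f : SimpleGraph.Copy H F, v ∈ Set.range f := by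
  classical
  have e : H.neighborFinset u ≃ C := Finset.equivOfCardEq (by rw [hC]; rfl)
  -- The default value is wanted at `u`; other values off the neighbourhood are discarded when `f`
  -- is restricted and extended to the bijection `g`.
  let f : V → Fin n := fun x => if h : x ∈ H.neighborFinset u then e ⟨x, h⟩ else v
  have hfN : ∀ x (h : x ∈ H.neighborFinset u), f x = e ⟨x, h⟩ := fun x h => dif_pos h
  have hfu : f u = v := dif_neg (by simp)
  have hfC : ∀ x ∈ H.neighborFinset u, f x ∈ C := fun x h => by
    rw [hfN x h]; exact (e _).2
  have himg : (insert u (H.neighborFinset u)).image f ⊆ insert v C' := by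
    intro y hy
    obtain ⟨x, hx, rfl⟩ := Finset.mem_image.1 hy
    rcases Finset.mem_insert.1 hx with rfl | hx
    · rw [hfu]; exact Finset.mem_insert_self _ _
    · exact Finset.mem_insert_of_mem (hCC' (hfC x hx))
  have hinj : Set.InjOn f (insert u (H.neighborFinset u) : Finset V) := by
    intro a ha b hb hab
    rw [Finset.mem_coe, Finset.mem_insert] at ha hb
    rcases ha with rfl | ha <;> rcases hb with rfl | hb
    · rfl
    · rw [hfu] at hab
      exact absurd (hCC' (hfC b hb)) (hab ▸ hv)
    · rw [hfu] at hab
      exact absurd (hCC' (hfC a ha)) (hab ▸ hv)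
    · rw [hfN a ha, hfN b hb] at hab
      simpa using e.injective (Subtype.ext hab)
  obtain ⟨g, hg⟩ := Finset.exists_equiv_extend_of_card_eq (t := insert v C')
    (by rw [Finset.card_insert_of_notMem hv, hC']) himg hinj
  have hgu : (g u : Fin n) = v := by rw [hg u (Finset.mem_insert_self _ _), hfu]
  have hgne : ∀ x, x ≠ u → (g x : Fin n) ∈ C' := fun x hx => by
    refine (Finset.mem_insert.1 (g x).2).resolve_left fun h => hx (g.injective (Subtype.ext ?_))
    rw [h, hgu]
  have hgadj : ∀ x, H.Adj u x → F.Adj v (g x) := fun x hx => by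
    have hx' : x ∈ H.neighborFinset u := by simpa using hx
    rw [hg x (Finset.mem_insert_of_mem hx')]
    exact hadj _ (hfC x hx')
  refine ⟨⟨⟨fun x => g x, fun {a b} hab => ?_⟩, fun a b h => g.injective (Subtype.ext h)⟩, u, hgu⟩
  by_cases ha : a = u
  · subst ha
    rw [hgu]
    exact hgadj b hab
  · by_cases hb : b = u
    · subst hb
      rw [hgu]
      exact (hgadj a hab.symm).symm
    · exact hclique (hgne a ha) (hgne b hb) fun h => hab.ne (g.injective (Subtype.ext h))

theorem isUpperSet_coveredBy (H : SimpleGraph V) : IsUpperSet (coveredBy H n) := by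
  intro F F' hF h v
  obtain ⟨f, hf⟩ := h v
  exact ⟨(SimpleGraph.Copy.ofLE F F' hF).comp f, hf⟩

/-- All vertices start from the same empty clique of depth `D`. Each pass trades one level of depth
for one neighbour; the levels left over complete the clique to `D` vertices avoiding `v`. -/
theorem bot_mem_reaches_coveredBy [Fintype V] [Nonempty V] (H : SimpleGraph V) [DecidableRel H.Adj]
    {t L : ℕ} (ht : 0 < t) (hL : 2 * t + 1 ≤ L) (hn : L ^ (Fintype.card V - 1) ≤ n) :
    (⊥ : SimpleGraph (Fin n)) ∈ reaches (coveredBy H n)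
      (buildList (2 * t + 1) L (Fintype.card V - 1) ++
        (List.range H.minDegree).flatMap fun _ => joinList t n) := by
  classical
  set D := Fintype.card V - 1 with hD
  have hd : H.minDegree ≤ D := by have := H.minDegree_lt_card; omega
  rw [reaches_append]
  refine reaches_mono ?_ _ (mem_reaches_branching (by omega) hL D (C := ∅) (A := Finset.univ)
    (by simp) (by simpa using hn) (by simp))
  intro F hF
  refine reaches_mono ?_ _ (reaches_flatMap_range
    (P := fun l => {F | ∀ v, JoinedTo (2 * t + 1) F (D - l) l v}) (fun l hl => ?_)
    fun v => ⟨∅, rfl, hF, by simp⟩)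
  · intro F hF v
    obtain ⟨C, hC, hb, hadj⟩ := hF v
    obtain ⟨u, hu⟩ := H.exists_minimal_degree_vertex
    obtain ⟨C', h1, h2, h3, h4⟩ := hb.exists_clique (v := v) (by omega)
      fun h => (hadj v h).ne rfl
    have := Fintype.card_pos (α := V)
    exact exists_copy_of_clique H u h1 (hC.trans hu) (by omega) h3 h4 hadj
  · have := reaches_joinedTo (n := n) t (D - (l + 1)) l
    rwa [show D - (l + 1) + 1 = D - l by omega] at this

end Copies

/-! ### The deterministic lower bound -/

section LowerBound

variable {n : ℕ} {V : Type*} [Fintype V]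

theorem ncard_edgeSet_builtGraph_le (σ : Strategy n) (T : ℕ → SpanningTree n) (i : ℕ) :
    (builtGraph σ T i).edgeSet.ncard ≤ i := by
  induction i with
  | zero => simp [builtGraph]
  | succ i ih =>
    simp only [builtGraph, SimpleGraph.edgeSet_sup, SimpleGraph.edgeSet_fromEdgeSet]
    refine (Set.ncard_union_le _ _).trans (Nat.add_le_add ih ?_)
    exact (Set.ncard_le_ncard Set.sdiff_subset).trans (by simp)

theorem minDegree_mul_le_of_mem_coveredBy (H : SimpleGraph V) [DecidableRel H.Adj]
    {G : SimpleGraph (Fin n)} (hG : G ∈ coveredBy H n) :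
    H.minDegree * n ≤ 2 * G.edgeSet.ncard := by
  classical
  have hdeg : ∀ v, H.minDegree ≤ G.degree v := by
    intro v
    obtain ⟨f, u, rfl⟩ := hG v
    refine (H.minDegree_le_degree u).trans ?_
    exact Finset.card_le_card_of_injOn f
      (fun x hx => by
        simp only [Finset.mem_coe, SimpleGraph.mem_neighborFinset] at hx ⊢
        exact f.toHom.map_adj hx) f.injective.injOn
  have h := G.sum_degrees_eq_twice_card_edges
  rw [← SimpleGraph.coe_edgeFinset, Set.ncard_coe_finset, ← h]
  calc H.minDegree * n = (Finset.univ : Finset (Fin n)).card • H.minDegree := by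
        simp [mul_comm]
    _ ≤ _ := Finset.card_nsmul_le_sum _ _ _ fun v _ => hdeg v

theorem minDegree_mul_le_hittingRound (H : SimpleGraph V) [DecidableRel H.Adj]
    (σ : Strategy n) (T : ℕ → SpanningTree n) :
    ((H.minDegree * n : ℕ) : ℕ∞) ≤ 2 * hittingRound σ (coveredBy H n) T := by
  by_cases h : ∃ i, builtGraph σ T i ∈ coveredBy H n
  · have hne : Nonempty {i // builtGraph σ T i ∈ coveredBy H n} := by
      obtain ⟨i, hi⟩ := h; exact ⟨⟨i, hi⟩⟩
    rw [hittingRound, iInf_subtype']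
    obtain ⟨⟨i, hi⟩, heq⟩ := ENat.exists_eq_iInf
      fun x : {i // builtGraph σ T i ∈ coveredBy H n} => ((x : ℕ) : ℕ∞)
    rw [← heq]
    have h1 := minDegree_mul_le_of_mem_coveredBy H hi
    have h2 := ncard_edgeSet_builtGraph_le σ T i
    exact_mod_cast h1.trans (Nat.mul_le_mul_left 2 h2)
  · push Not at h
    have : hittingRound σ (coveredBy H n) T = ⊤ := by
      simp [hittingRound, h]
    rw [this, ENat.mul_top (by norm_num)]
    exact le_top

end LowerBound

/-! ### Length and expected waste of the plans -/

section Cost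

open scoped ENNReal

/-- The sum of the reciprocals of the entries of a list. -/
noncomputable def invSum (qs : List ℕ) : ℝ := (qs.map fun q : ℕ => (q : ℝ)⁻¹).sum

theorem invSum_append (qs qs' : List ℕ) : invSum (qs ++ qs') = invSum qs + invSum qs' := by
  simp [invSum]

theorem invSum_flatMap_range (b : ℕ) (l : ℕ → List ℕ) :
    invSum ((List.range b).flatMap l) = ∑ j ∈ Finset.range b, invSum (l j) := by
  induction b with
  | zero => simp [invSum]
  | succ b ih =>
    rw [List.range_succ, List.flatMap_append, invSum_append, ih, Finset.sum_range_succ]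
    simp

theorem length_flatMap_range (b : ℕ) (l : ℕ → List ℕ) :
    ((List.range b).flatMap l).length = ∑ j ∈ Finset.range b, (l j).length := by
  induction b with
  | zero => simp
  | succ b ih =>
    rw [List.range_succ, List.flatMap_append, List.length_append, ih, Finset.sum_range_succ]
    simp

theorem sum_map_div_eq_ofReal (n : ℕ) {qs : List ℕ} (h : ∀ q ∈ qs, 0 < q) :
    (qs.map fun q : ℕ => (n : ℝ≥0∞) / q).sum = ENNReal.ofReal (n * invSum qs) := by
  induction qs with
  | nil => simp [invSum]
  | cons q qs ih =>
    have hq : (0 : ℝ) < q := by exact_mod_cast h q (by simp)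
    have hnn : 0 ≤ invSum qs := List.sum_nonneg (by simp)
    rw [List.map_cons, List.sum_cons, ih fun q hq => h q (by simp [hq])]
    have : invSum (q :: qs) = (q : ℝ)⁻¹ + invSum qs := by simp [invSum]
    rw [this, mul_add, ENNReal.ofReal_add (by positivity) (by positivity), ← div_eq_mul_inv,
      ENNReal.ofReal_div_of_pos hq, ENNReal.ofReal_natCast, ENNReal.ofReal_natCast]

theorem pos_of_mem_buildList {M L : ℕ} (hL : 2 ≤ L) {i q : ℕ} (h : q ∈ buildList M L i) : 0 < q := by
  induction i with
  | zero => simp [buildList] at h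
  | succ i ih =>
    simp only [buildList, List.mem_flatMap, List.mem_append, List.mem_singleton] at h
    obtain ⟨-, -, ⟨-, -, rfl⟩ | h⟩ := h
    · exact Nat.sub_pos_of_lt (Nat.pow_lt_pow_right (by omega) (by omega))
    · exact ih h

/-- With `L = N + 1` each star consists of `L ^ i` steps with `L ^ i * N` choices, so it costs `1 /
N` whatever `i` is; the cost satisfies `c (i + 1) = M * (1 / N + c i)`. -/
theorem invSum_buildList_le {M N : ℕ} (hM : 1 ≤ M) (hN : 1 ≤ N) (i : ℕ) :
    invSum (buildList M (N + 1) i) ≤ i * M ^ i / N := by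
  have hN' : (0 : ℝ) < N := by exact_mod_cast hN
  have hM' : (1 : ℝ) ≤ M := by exact_mod_cast hM
  induction i with
  | zero => simp [invSum, buildList]
  | succ i ih =>
    have h1 : invSum [(N + 1) ^ (i + 1) - (N + 1) ^ i] = ((N + 1 : ℝ) ^ i)⁻¹ * (N : ℝ)⁻¹ := by
      have : (N + 1) ^ (i + 1) - (N + 1) ^ i = (N + 1) ^ i * N := by
        rw [pow_succ, mul_add, mul_one, Nat.add_sub_cancel]
      simp [invSum, this, mul_comm]
    have h2 : invSum (buildList M (N + 1) (i + 1)) =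
        M * ((N : ℝ)⁻¹ + invSum (buildList M (N + 1) i)) := by
      rw [buildList, invSum_flatMap_range]
      simp only [invSum_append, invSum_flatMap_range, Finset.sum_const, Finset.card_range,
        nsmul_eq_mul, h1]
      push_cast
      rw [← mul_assoc, mul_inv_cancel₀ (by positivity), one_mul]
    rw [h2]
    calc (M : ℝ) * ((N : ℝ)⁻¹ + invSum (buildList M (N + 1) i))
        ≤ M * ((M : ℝ) ^ i / N + i * M ^ i / N) := by
          gcongr
          rw [inv_eq_one_div]
          gcongr
          exact one_le_pow₀ hM'
      _ = _ := by push_cast; ring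

theorem length_buildList_le {M L : ℕ} (hM : 1 ≤ M) (hL : 1 ≤ L) (i : ℕ) :
    (buildList M L i).length ≤ i * (M * L) ^ i := by
  induction i with
  | zero => simp [buildList]
  | succ i ih =>
    rw [buildList, length_flatMap_range]
    simp only [List.length_append, length_flatMap_range, Finset.sum_const, Finset.card_range,
      smul_eq_mul, List.length_singleton, mul_one]
    have h1 : L ^ i ≤ (M * L) ^ i := Nat.pow_le_pow_left (Nat.le_mul_of_pos_left L hM) i
    calc M * (L ^ i + (buildList M L i).length) ≤ M * ((M * L) ^ i + i * (M * L) ^ i) := by gcongr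
      _ = (i + 1) * (M * (M * L) ^ i) := by ring
      _ ≤ (i + 1) * (M * L * (M * L) ^ i) := by
          gcongr
          exact Nat.le_mul_of_pos_right M hL
      _ = _ := by ring

theorem pos_of_mem_joinList {t n q : ℕ} (ht : 0 < t) (h : q ∈ joinList t n) : 0 < q := by
  simp only [joinList, List.mem_flatMap, List.mem_range, List.mem_singleton] at h
  obtain ⟨j, hj, rfl⟩ := h
  exact Nat.mul_pos ht (by omega)

theorem length_joinList (t n : ℕ) : (joinList t n).length = n := by
  simp [joinList]

theorem invSum_joinList_le (t n : ℕ) : invSum (joinList t n) ≤ (1 + Real.log n) / t := by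
  have h : invSum (joinList t n) = (harmonic n : ℝ) / t := by
    rw [joinList, invSum_flatMap_range, harmonic, Rat.cast_sum, Finset.sum_div,
      ← Finset.sum_range_reflect]
    refine Finset.sum_congr rfl fun j hj => ?_
    have hj := Finset.mem_range.1 hj
    simp only [invSum, List.map_cons, List.map_nil, List.sum_cons, List.sum_nil, add_zero]
    have : n - (n - 1 - j) = j + 1 := by omega
    rw [this]
    push_cast
    rw [mul_inv, div_eq_mul_inv, mul_comm]
  rw [h]
  gcongr
  exact harmonic_le_one_add_log n

end Cost

/-! ### Choice of parameters and asymptotics -/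

section Growth

theorem natLog_isLittleO (p : ℕ) :
    (fun m : ℕ => (Nat.log 2 m : ℝ) ^ p) =o[atTop] fun m : ℕ => (m : ℝ) := by
  have h1 : (fun m : ℕ => (Nat.log 2 m : ℝ)) =O[atTop] fun m : ℕ => Real.log m := by
    refine IsBigO.of_bound (Real.log 2)⁻¹ (Eventually.of_forall fun m => ?_)
    have h := Real.natLog_le_logb m 2
    have h0 := Real.log_natCast_nonneg m
    rw [Real.norm_of_nonneg (by positivity), Real.norm_of_nonneg h0]
    calc (Nat.log 2 m : ℝ) ≤ Real.logb 2 m := by exact_mod_cast h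
      _ = _ := by rw [Real.logb, div_eq_mul_inv, mul_comm]
  exact (h1.pow p).trans_isLittleO
    ((Real.isLittleO_pow_log_id_atTop (n := p)).comp_tendsto tendsto_natCast_atTop_atTop)

theorem tendsto_natLog_atTop : Tendsto (fun m : ℕ => Nat.log 2 m) atTop atTop := by
  refine tendsto_atTop.2 fun b => ?_
  filter_upwards [eventually_ge_atTop (2 ^ b)] with m hm
  exact Nat.le_log_of_pow_le (by norm_num) hm

/-- The number of choices for each further neighbour of a vertex, for `m` vertices. -/
def choices (m : ℕ) : ℕ := Nat.log 2 m ^ 3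

/-- The branching number of the cliques to be built, for `m` vertices. -/
def width (m : ℕ) : ℕ := 2 * choices m + 1

/-- This polylogarithmic quantity controls both the length of the clique-building plan and the
number of vertices that it needs. -/
theorem width_mul_pow_isLittleO (D : ℕ) :
    (fun m : ℕ => (((width m * (width m ^ (D + 1) + 1)) ^ D : ℕ) : ℝ)) =o[atTop]
      fun m : ℕ => (m : ℝ) := by
  refine IsBigO.trans_isLittleO ?_ (natLog_isLittleO (3 * (D + 2) * D))
  refine IsBigO.of_bound ((2 * 3 ^ (D + 2)) ^ D : ℕ) ?_
  filter_upwards [tendsto_natLog_atTop.eventually_ge_atTop 1] with m hm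
  rw [Real.norm_of_nonneg (by positivity), Real.norm_of_nonneg (by positivity)]
  norm_cast
  have hc : 1 ≤ choices m := Nat.one_le_pow _ _ hm
  have h1 : width m ≤ 3 * choices m := by unfold width; omega
  have h2 : 1 ≤ width m ^ (D + 1) := Nat.one_le_pow _ _ (by unfold width; omega)
  calc (width m * (width m ^ (D + 1) + 1)) ^ D
      ≤ (width m * (width m ^ (D + 1) + width m ^ (D + 1))) ^ D := by gcongr
    _ = (2 * width m ^ (D + 2)) ^ D := by ring
    _ ≤ (2 * (3 * choices m) ^ (D + 2)) ^ D := by gcongr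
    _ = _ := by
        rw [choices, mul_pow 3, ← mul_assoc, mul_pow (2 * 3 ^ (D + 2)), ← pow_mul, ← pow_mul,
          mul_assoc]

theorem div_natLog_isLittleO :
    (fun m : ℕ => ((m / Nat.log 2 m : ℕ) : ℝ)) =o[atTop] fun m : ℕ => (m : ℝ) := by
  have h1 : (fun m : ℕ => ((Nat.log 2 m : ℕ) : ℝ)⁻¹) =o[atTop] fun _ : ℕ => (1 : ℝ) := by
    rw [isLittleO_one_iff]
    exact tendsto_inv_atTop_zero.comp (tendsto_natCast_atTop_atTop.comp tendsto_natLog_atTop)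
  have h2 := (isBigO_refl (fun m : ℕ => (m : ℝ)) atTop).mul_isLittleO h1
  simp only [mul_one] at h2
  refine IsBigO.trans_isLittleO (IsBigO.of_bound 1 (Eventually.of_forall fun m => ?_)) h2
  rw [Real.norm_of_nonneg (by positivity), Real.norm_of_nonneg (by positivity), one_mul,
    ← div_eq_mul_inv]
  exact Nat.cast_div_le

end Growth

/-! ### The upper bound -/

section UpperBound

variable {V : Type*} [Fintype V] [Nonempty V]

/-- The expected waste is `O(m / log² m)`, against a slack of `m / log m` rounds, so Markov's
inequality leaves a failure probability `O(1 / log m)`. -/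
theorem exists_strategy_coveredBy (H : SimpleGraph V) [DecidableRel H.Adj] (m : ℕ) [NeZero m]
    (hm : 2 ≤ m)
    (hw : (width m ^ (Fintype.card V - 1 + 1) + 1) ^ (Fintype.card V - 1) ≤ m) :
    ∃ σ : Strategy m, treeLaw m {T | builtGraph σ T
        ((buildList (width m) (width m ^ (Fintype.card V - 1 + 1) + 1) (Fintype.card V - 1)).length
          + H.minDegree * m + m / Nat.log 2 m) ∉ coveredBy H m} ≤
      ENNReal.ofReal (((Fintype.card V - 1 : ℕ) + 3 * H.minDegree : ℝ) / Nat.log 2 m) := by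
  set D := Fintype.card V - 1
  set l := Nat.log 2 m with hl
  have hl1 : 1 ≤ l := Nat.log_pos (by norm_num) hm
  have ht : 0 < choices m := Nat.pow_pos hl1
  have hwpos : 1 ≤ width m := by unfold width; omega
  have hwle : width m ≤ width m ^ (D + 1) + 1 :=
    (Nat.le_self_pow (by omega) _).trans (Nat.le_succ _)
  set N := width m ^ (D + 1) with hN
  have hN1 : 1 ≤ N := Nat.one_le_pow _ _ hwpos
  obtain ⟨σ, hσ⟩ := exists_strategy_of_reaches hm (isUpperSet_coveredBy H) _
    (bot_mem_reaches_coveredBy H ht hwle hw)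
  refine ⟨σ, ?_⟩
  have h := hσ (m / l)
  rw [List.length_append, length_flatMap_range] at h
  simp only [length_joinList, Finset.sum_const, Finset.card_range, smul_eq_mul] at h
  refine h.trans ?_
  rw [sum_map_div_eq_ofReal]
  swap
  · intro q hq
    rcases List.mem_append.1 hq with hq | hq
    · exact pos_of_mem_buildList (by omega) hq
    · obtain ⟨-, -, hq⟩ := List.mem_flatMap.1 hq
      exact pos_of_mem_joinList ht hq
  rw [← ENNReal.ofReal_natCast, ← ENNReal.ofReal_div_of_pos (by positivity)]
  refine ENNReal.ofReal_le_ofReal ?_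
  rw [invSum_append, invSum_flatMap_range]
  simp only [Finset.sum_const, Finset.card_range, nsmul_eq_mul]
  have hlR : (1 : ℝ) ≤ l := by exact_mod_cast hl1
  have hA : invSum (buildList (2 * choices m + 1) (N + 1) D) ≤ D / (l : ℝ) ^ 2 := by
    refine (invSum_buildList_le (M := width m) hwpos hN1 D).trans ?_
    have hwR : (0 : ℝ) < width m := by exact_mod_cast hwpos
    have : (D : ℝ) * (width m : ℝ) ^ D / (N : ℕ) = D / width m := by
      rw [hN]; push_cast; field_simp; ring
    rw [this]
    gcongr
    have : l ^ 2 ≤ width m := by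
      have : l ^ 2 ≤ l ^ 3 := Nat.pow_le_pow_right hl1 (by norm_num)
      rw [width, choices, ← hl]
      omega
    exact_mod_cast this
  -- The harmonic sum is at most `l + 2 ≤ 3 * l`; dividing by `choices m = l ^ 3` leaves `3 / l ^
  -- 2`.
  have hB : invSum (joinList (choices m) m) ≤ 3 / (l : ℝ) ^ 2 := by
    refine (invSum_joinList_le _ _).trans ?_
    have hlog : Real.log m ≤ l + 1 := by
      have h1 : (m : ℝ) ≤ 2 ^ (l + 1) := by
        exact_mod_cast (Nat.lt_pow_succ_log_self (by norm_num) m).le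
      have hm0 : (0 : ℝ) < m := by positivity
      calc Real.log m ≤ Real.log (2 ^ (l + 1)) := Real.log_le_log hm0 h1
        _ = (l + 1 : ℕ) * Real.log 2 := Real.log_pow _ _
        _ ≤ (l + 1 : ℕ) * 1 := by
            gcongr
            linarith [Real.log_two_lt_d9]
        _ = l + 1 := by push_cast; ring
    rw [choices, ← hl]
    push_cast
    rw [div_le_div_iff₀ (by positivity) (by positivity)]
    nlinarith [pow_pos (by positivity : (0 : ℝ) < l) 2]
  have hdiv : (m : ℝ) ≤ l * ((m / l : ℕ) + 1 : ℕ) := by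
    exact_mod_cast (Nat.lt_mul_div_succ m hl1).le
  rw [div_le_div_iff₀ (by positivity) (by positivity)]
  calc (m : ℝ) * (invSum (buildList (2 * choices m + 1) (N + 1) D)
          + H.minDegree * invSum (joinList (choices m) m)) * l
      ≤ (l * ((m / l : ℕ) + 1 : ℕ)) * (D / (l : ℝ) ^ 2 + H.minDegree * (3 / (l : ℝ) ^ 2)) * l := by
        gcongr
        have h1 : 0 ≤ invSum (buildList (2 * choices m + 1) (N + 1) D) :=
          List.sum_nonneg (by simp)
        have h2 : 0 ≤ invSum (joinList (choices m) m) := List.sum_nonneg (by simp)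
        positivity
    _ = _ := by field_simp

end UpperBound

/-- First part: there are strategies `σ n` on `n + 2` vertices (on one vertex there is no edge to
select, hence no strategy) that cover all vertices by copies of `H` within `d_min(H) m + o(m)`
rounds whp, where `m = n + 2` is the number of vertices.
Second part: the deterministic lower bound `d_min(H) n / 2` for all strategies. -/
theorem mainTheorem5 {V : Type*} [Fintype V] [Nonempty V]
    (H : SimpleGraph V) [DecidableRel H.Adj] :
    (∃ (σ : (n : ℕ) → Strategy (n + 2)) (f : ℕ → ℕ),
      ((fun m : ℕ => (f m : ℝ)) =o[atTop] fun m : ℕ => (m : ℝ)) ∧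
      Tendsto
        (fun n : ℕ => treeLaw (n + 2)
          {T | hittingRound (σ n) (coveredBy H (n + 2)) T
            ≤ ((H.minDegree * (n + 2) + f (n + 2) : ℕ) : ℕ∞)})
        atTop (𝓝 1)) ∧
    (∀ (n : ℕ) (σ : Strategy n) (T : ℕ → SpanningTree n),
      ((H.minDegree * n : ℕ) : ℕ∞) ≤ 2 * hittingRound σ (coveredBy H n) T) := by
  refine ⟨?_, fun n σ T => minDegree_mul_le_hittingRound H σ T⟩
  set D := Fintype.card V - 1 with hD
  set s : ℕ → ℕ := fun m => (buildList (width m) (width m ^ (D + 1) + 1) D).length with hs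
  have hex : ∀ n : ℕ, ∃ σ : Strategy (n + 2),
      (width (n + 2) ^ (D + 1) + 1) ^ D ≤ n + 2 →
      treeLaw (n + 2) {T | builtGraph σ T
        (s (n + 2) + H.minDegree * (n + 2) + (n + 2) / Nat.log 2 (n + 2)) ∉ coveredBy H (n + 2)} ≤
      ENNReal.ofReal ((D + 3 * H.minDegree : ℝ) / Nat.log 2 (n + 2)) := by
    intro n
    by_cases hw : (width (n + 2) ^ (D + 1) + 1) ^ D ≤ n + 2
    · obtain ⟨σ, hσ⟩ := exists_strategy_coveredBy H (n + 2) (by omega) hw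
      exact ⟨σ, fun _ => hσ⟩
    -- When there are too few vertices for the plan, any strategy will do.
    · obtain ⟨σ, -⟩ := exists_strategy_of_wish (n := n + 2) (by omega) fun _ => ∅
      exact ⟨σ, fun h => absurd h hw⟩
  choose σ hσ using hex
  have hsmall := width_mul_pow_isLittleO D
  have hshift : Tendsto (fun n : ℕ => n + 2) atTop atTop := tendsto_add_atTop_nat 2
  refine ⟨σ, fun m => s m + m / Nat.log 2 m, ?_, ?_⟩
  · have h1 : (fun m : ℕ => (s m : ℝ)) =o[atTop] fun m : ℕ => (m : ℝ) := by
      refine IsBigO.trans_isLittleO (IsBigO.of_bound D (Eventually.of_forall fun m => ?_)) hsmall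
      rw [Real.norm_of_nonneg (by positivity), Real.norm_of_nonneg (by positivity)]
      exact_mod_cast length_buildList_le (by unfold width; omega) (by omega) D
    simpa using h1.add div_natLog_isLittleO
  · have hlim : Tendsto (fun n : ℕ => 1 - ENNReal.ofReal
        ((D + 3 * H.minDegree : ℝ) / Nat.log 2 (n + 2))) atTop (𝓝 1) := by
      have h0 : Tendsto (fun n : ℕ => (D + 3 * H.minDegree : ℝ) / Nat.log 2 (n + 2)) atTop
          (𝓝 0) := Tendsto.const_div_atTop (tendsto_natCast_atTop_atTop.comp
            (tendsto_natLog_atTop.comp hshift)) _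
      have h1 := ENNReal.tendsto_ofReal h0
      rw [ENNReal.ofReal_zero] at h1
      simpa using ENNReal.Tendsto.sub (tendsto_const_nhds (x := (1 : ENNReal))) h1 (by simp)
    have hpr : ∀ n : ℕ, IsProbabilityMeasure (treeLaw (n + 2)) := fun n => by
      unfold treeLaw; infer_instance
    refine tendsto_of_tendsto_of_tendsto_of_le_of_le' hlim tendsto_const_nhds ?_
      (Eventually.of_forall fun n => prob_le_one)
    have hev : ∀ᶠ m : ℕ in atTop, (width m ^ (D + 1) + 1) ^ D ≤ m := by
      filter_upwards [hsmall.bound zero_lt_one] with m hm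
      rw [Real.norm_of_nonneg (by positivity), Real.norm_of_nonneg (by positivity), one_mul] at hm
      refine le_trans (Nat.pow_le_pow_left ?_ D) (by exact_mod_cast hm)
      exact Nat.le_mul_of_pos_left _ (by unfold width; omega)
    filter_upwards [hshift.eventually hev] with n hn
    have h := hσ n hn
    set S := {T | hittingRound (σ n) (coveredBy H (n + 2)) T
      ≤ ((H.minDegree * (n + 2) + (s (n + 2) + (n + 2) / Nat.log 2 (n + 2)) : ℕ) : ℕ∞)}
    have hsub : Sᶜ ⊆ {T | builtGraph (σ n) T
        (s (n + 2) + H.minDegree * (n + 2) + (n + 2) / Nat.log 2 (n + 2)) ∉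
          coveredBy H (n + 2)} := by
      intro T hT hmem
      have h1 : hittingRound (σ n) (coveredBy H (n + 2)) T ≤ _ :=
        iInf₂_le (f := fun (i : ℕ) (_ : builtGraph (σ n) T i ∈ coveredBy H (n + 2)) => (i : ℕ∞))
          _ hmem
      refine hT (h1.trans (Nat.cast_le.2 ?_))
      omega
    rw [tsub_le_iff_right]
    -- Subadditivity suffices, so `S` need not be shown measurable.
    calc (1 : ENNReal) = treeLaw (n + 2) (S ∪ Sᶜ) := by rw [Set.union_compl_self, measure_univ]
      _ ≤ treeLaw (n + 2) S + treeLaw (n + 2) Sᶜ := measure_union_le _ _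
      _ ≤ _ := by gcongr; exact (measure_mono hsub).trans h
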